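/- A \emph{generalized odd Durfee symbol} for $n$ is a two-rowed array $$\begin{pmatrix} a_1 & a_2 & \cdots & a_i\\ b_1 & b_2 & \cdots & b_j\end{pmatrix}_{\lambda,\mu,t}$$ where $t\ge 0$ is an integer, $\lambda$ and $\mu$ are (possibly empty) partitions into distinct odd parts of size at most $2t-1$, each row is a (possibly empty) partition, written in non-increasing order, into odd parts of size at most $2t+1$, and $n$ is the sum of all the parts in the two rows, in $\lambda$ and in $\mu$, plus $2t+1$. Its \emph{rank} is $i-j$. An odd number $2x-1$ with $1\le x\le t$ is \emph{missing} from $\lambda$ (or $\mu$) if it is not a part of it. Let $N^o(r,s,m,n)$ be the number of generalized odd Durfee symbols for $n$ of rank $m$ with exactly $r$ numbers missing from $\lambda$ and exactly $s$ missing from $\mu$, and let $$\eta^o_k(r,s,n)=\sum_{m\in\mathbb Z}\binom{m+\lfloor k/2\rfloor}{k}N^o(r,s,m,n)$$ be the \emph{$k$th symmetrized rank moment}, where $\binom{x}{k}=x(x-1)\cdots(x-k+1)/k!$ for every integer $x$. For $k\ge 2$, a \emph{$k$-marked generalized odd Durfee symbol} for $n$ is a generalized odd Durfee symbol for $n$ each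 of whose entries in the two rows carries a colour in $\{1,\dots,k\}$, such that: (1) in each row the sequence of parts and the sequence of colours are both non-increasing; (2) each of the colours $1,\dots,k-1$ occurs at least once in the top row; (3) if $M_c$ denotes the largest part of colour $c$ in the top row for $1\le c\le k-1$, and $M_0=1$, $M_k=2t+1$, then for every $1\le c\le k$ all parts of colour $c$ in the bottom row lie in $[M_{c-1},M_c]$. Let $\mathcal D^o_k(r,s,n)$ be the number of $k$-marked generalized odd Durfee symbols for $n$ with exactly $r$ numbers missing from $\lambda$ and exactly $s$ missing from $\mu$. Corollary. For all integers $k\ge 1$ and $r,s,n\ge 0$, $$\eta^o_{2k}(r,s,n)=\mathcal D^o_{k+1}(r,s,n).$$ -/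

import Mathlib

/-- A generalized odd Durfee symbol: a two-rowed array `(a₁ a₂ ⋯ / b₁ b₂ ⋯)` with subscripts
`lam`, `mu`, `t`.  The rows are partitions (non-increasing lists) into odd parts of size at most
`2t + 1`; `lam` and `mu` are partitions into distinct odd parts of size at most `2t - 1`. -/
@[ext]
structure OddDurfeeSymbol where
  top : List ℕ
  bottom : List ℕ
  lam : Finset ℕ
  mu : Finset ℕ
  t : ℕ
  top_sorted : top.Pairwise (fun a b => b ≤ a)
  bottom_sorted : bottom.Pairwise (fun a b => b ≤ a)
  top_parts : ∀ a ∈ top, Odd a ∧ a ≤ 2 * t + 1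
  bottom_parts : ∀ b ∈ bottom, Odd b ∧ b ≤ 2 * t + 1
  lam_parts : ∀ p ∈ lam, Odd p ∧ p + 1 ≤ 2 * t
  mu_parts : ∀ p ∈ mu, Odd p ∧ p + 1 ≤ 2 * t

namespace OddDurfeeSymbol

/-- The number for which `δ` is a symbol. -/
def size (δ : OddDurfeeSymbol) : ℕ :=
  δ.top.sum + δ.bottom.sum + (∑ p ∈ δ.lam, p) + (∑ p ∈ δ.mu, p) + (2 * δ.t + 1)

/-- The number of odd numbers `2x - 1`, `1 ≤ x ≤ t`, that do not occur in `ν`. -/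
def missing (t : ℕ) (ν : Finset ℕ) : ℕ :=
  ((Finset.Icc 1 t).filter (fun x => 2 * x - 1 ∉ ν)).card

/-- The number of entries of the top row minus the number of entries of the bottom row. -/
def rank (δ : OddDurfeeSymbol) : ℤ := (δ.top.length : ℤ) - (δ.bottom.length : ℤ)

end OddDurfeeSymbol

/-- The generalized odd Durfee symbols for `n` of rank `m` with `r` parts missing from `lam`
and `s` parts missing from `mu`. -/
def oddDurfeeSymbolSet (r s : ℕ) (m : ℤ) (n : ℕ) : Set OddDurfeeSymbol :=
  {δ | δ.size = n ∧ OddDurfeeSymbol.missing δ.t δ.lam = r ∧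
    OddDurfeeSymbol.missing δ.t δ.mu = s ∧ δ.rank = m}

/-- `N^o(r,s,m,n)`. -/
noncomputable def oddDurfeeCount (r s : ℕ) (m : ℤ) (n : ℕ) : ℕ :=
  (oddDurfeeSymbolSet r s m n).ncard

/-- The `k`-th symmetrized rank moment
`η_k^o(r,s,n) = ∑_{m ∈ ℤ} binom(m + ⌊k/2⌋, k) N^o(r,s,m,n)`, where `binom(x, k)` is
`x (x - 1) ⋯ (x - k + 1) / k!` for every integer `x`. -/
noncomputable def symmetrizedOddRankMoment (k r s n : ℕ) : ℤ :=
  ∑ᶠ m : ℤ, Ring.choose (m + ((k / 2 : ℕ) : ℤ)) k * (oddDurfeeCount r s m n : ℤ)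

/-- The largest part with colour `c` in a row of coloured parts `(part, colour)`
(`0` if there is none). -/
def largestOfColour (row : List (ℕ × ℕ)) (c : ℕ) : ℕ :=
  ((row.filter (fun e => e.2 = c)).map Prod.fst).foldr max 0

/-- The left endpoint of the interval for the bottom parts of colour `c`: `1` for `c = 1`, and
the largest top part of colour `c - 1` for `c ≥ 2`. -/
def lowerEnd (top : List (ℕ × ℕ)) (c : ℕ) : ℕ :=
  if c = 1 then 1 else largestOfColour top (c - 1)

/-- The right endpoint of the interval for the bottom parts of colour `c`: the largest top part
of colour `c` for `c < k`, and `2t + 1` for `c = k`. -/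
def upperEnd (k t : ℕ) (top : List (ℕ × ℕ)) (c : ℕ) : ℕ :=
  if c = k then 2 * t + 1 else largestOfColour top c

/-- A `k`-marked generalized odd Durfee symbol: a generalized odd Durfee symbol whose entries
carry colours in `{1, …, k}`; each entry of a row is a pair `(part, colour)`. -/
@[ext]
structure MarkedOddDurfeeSymbol (k : ℕ) where
  top : List (ℕ × ℕ)
  bottom : List (ℕ × ℕ)
  lam : Finset ℕ
  mu : Finset ℕ
  t : ℕ
  top_parts : ∀ e ∈ top, Odd e.1 ∧ e.1 ≤ 2 * t + 1
  bottom_parts : ∀ e ∈ bottom, Odd e.1 ∧ e.1 ≤ 2 * t + 1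
  lam_parts : ∀ p ∈ lam, Odd p ∧ p + 1 ≤ 2 * t
  mu_parts : ∀ p ∈ mu, Odd p ∧ p + 1 ≤ 2 * t
  top_colours : ∀ e ∈ top, 1 ≤ e.2 ∧ e.2 ≤ k
  bottom_colours : ∀ e ∈ bottom, 1 ≤ e.2 ∧ e.2 ≤ k
  /-- In each row the sequence of parts and the sequence of colours are non-increasing. -/
  top_sorted : top.Pairwise (fun e f => f.1 ≤ e.1 ∧ f.2 ≤ e.2)
  bottom_sorted : bottom.Pairwise (fun e f => f.1 ≤ e.1 ∧ f.2 ≤ e.2)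
  /-- Each of the colours `1, …, k - 1` occurs in the top row. -/
  colour_occurs : ∀ c, 1 ≤ c → c < k → ∃ e ∈ top, e.2 = c
  /-- A bottom part of colour `c` lies in the `c`-th interval. -/
  bottom_interval : ∀ e ∈ bottom, lowerEnd top e.2 ≤ e.1 ∧ e.1 ≤ upperEnd k t top e.2

namespace MarkedOddDurfeeSymbol

/-- The underlying generalized odd Durfee symbol: forget the colours. -/
def toSymbol {k : ℕ} (δ : MarkedOddDurfeeSymbol k) : OddDurfeeSymbol where
  top := δ.top.map Prod.fst
  bottom := δ.bottom.map Prod.fst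
  lam := δ.lam
  mu := δ.mu
  t := δ.t
  top_sorted := List.pairwise_map.2 (δ.top_sorted.imp fun h => h.1)
  bottom_sorted := List.pairwise_map.2 (δ.bottom_sorted.imp fun h => h.1)
  top_parts := by
    intro a ha
    obtain ⟨e, he, rfl⟩ := List.mem_map.1 ha
    exact δ.top_parts e he
  bottom_parts := by
    intro a ha
    obtain ⟨e, he, rfl⟩ := List.mem_map.1 ha
    exact δ.bottom_parts e he
  lam_parts := δ.lam_parts
  mu_parts := δ.mu_parts

end MarkedOddDurfeeSymbol

/-- The `k`-marked generalized odd Durfee symbols for `n` with `r` parts missing from `lam` and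
`s` parts missing from `mu`. -/
def markedOddDurfeeSymbolSet (k r s n : ℕ) : Set (MarkedOddDurfeeSymbol k) :=
  {δ | δ.toSymbol.size = n ∧ OddDurfeeSymbol.missing δ.t δ.lam = r ∧
    OddDurfeeSymbol.missing δ.t δ.mu = s}

/-- `D_k^o(r,s,n)`. -/
noncomputable def markedOddDurfeeCount (k r s n : ℕ) : ℕ :=
  (markedOddDurfeeSymbolSet k r s n).ncard

/-! The sets counted above are finite, and so is the support of the sum over the rank. -/

theorem finite_lists_of_length_le {α : Type*} {S : Set α} (hS : S.Finite) (n : ℕ) :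
    {l : List α | l.length ≤ n ∧ ∀ x ∈ l, x ∈ S}.Finite := by
  have : Finite S := hS
  refine ((List.finite_length_le S n).image (List.map Subtype.val)).subset ?_
  rintro l ⟨hl, hm⟩
  exact ⟨l.attachWith (· ∈ S) hm, by simpa using hl, by simp⟩

theorem length_le_sum_of_pos (l : List ℕ) (h : ∀ x ∈ l, Odd x) : l.length ≤ l.sum := by
  induction l with
  | nil => simp
  | cons a l ih =>
    have h1 := ih fun x hx => h x (List.mem_cons_of_mem _ hx)
    have h2 := (h a List.mem_cons_self).pos
    simp only [List.length_cons, List.sum_cons]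
    omega

theorem finite_markedOddDurfeeSymbol (k n : ℕ) :
    {δ : MarkedOddDurfeeSymbol k | δ.toSymbol.size ≤ n}.Finite := by
  let L : Set (List (ℕ × ℕ)) := {l | l.length ≤ n ∧ ∀ x ∈ l, x ∈ Set.Iic n ×ˢ Set.Iic k}
  have hL : L.Finite :=
    finite_lists_of_length_le ((Set.finite_Iic n).prod (Set.finite_Iic k)) n
  let P : Set (Finset ℕ) := {s | s ⊆ Finset.range (n + 1)}
  have hP : P.Finite := by
    refine ((Finset.range (n + 1)).powerset.finite_toSet).subset ?_
    intro s hs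
    exact Finset.mem_coe.2 (Finset.mem_powerset.2 hs)
  refine Set.Finite.of_finite_image
    (f := fun δ : MarkedOddDurfeeSymbol k => (δ.top, δ.bottom, δ.lam, δ.mu, δ.t))
    ((hL.prod (hL.prod (hP.prod (hP.prod (Set.finite_Iic n))))).subset ?_) ?_
  · rintro _ ⟨δ, hδ, rfl⟩
    have hsz : (δ.top.map Prod.fst).sum + (δ.bottom.map Prod.fst).sum + (∑ p ∈ δ.lam, p)
        + (∑ p ∈ δ.mu, p) + (2 * δ.t + 1) ≤ n := hδ
    have h1 := length_le_sum_of_pos _ (fun x hx => (δ.toSymbol.top_parts x hx).1)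
    have h2 := length_le_sum_of_pos _ (fun x hx => (δ.toSymbol.bottom_parts x hx).1)
    simp only [MarkedOddDurfeeSymbol.toSymbol, List.length_map] at h1 h2
    have h3 : δ.top.length ≤ n := by omega
    have h4 : δ.bottom.length ≤ n := by omega
    refine ⟨⟨h3, fun x hx => ⟨?_, (δ.top_colours x hx).2⟩⟩,
      ⟨h4, fun x hx => ⟨?_, (δ.bottom_colours x hx).2⟩⟩, fun p hp => ?_, fun p hp => ?_, ?_⟩
    · have := (δ.top_parts x hx).2
      simp only [Set.mem_Iic]; omega
    · have := (δ.bottom_parts x hx).2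
      simp only [Set.mem_Iic]; omega
    · have := (δ.lam_parts p hp).2
      simp only [Finset.mem_range]; omega
    · have := (δ.mu_parts p hp).2
      simp only [Finset.mem_range]; omega
    · simp only [Set.mem_Iic]; omega
  · intro δ _ ε _ h
    simp only [Prod.mk.injEq] at h
    exact MarkedOddDurfeeSymbol.ext h.1 h.2.1 h.2.2.1 h.2.2.2.1 h.2.2.2.2

theorem finite_oddDurfeeSymbol (n : ℕ) : {δ : OddDurfeeSymbol | δ.size ≤ n}.Finite := by
  let L : Set (List ℕ) := {l | l.length ≤ n ∧ ∀ x ∈ l, x ∈ Set.Iic n}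
  have hL : L.Finite := finite_lists_of_length_le (Set.finite_Iic n) n
  let P : Set (Finset ℕ) := {s | s ⊆ Finset.range (n + 1)}
  have hP : P.Finite := by
    refine ((Finset.range (n + 1)).powerset.finite_toSet).subset ?_
    intro s hs
    exact Finset.mem_coe.2 (Finset.mem_powerset.2 hs)
  refine Set.Finite.of_finite_image
    (f := fun δ : OddDurfeeSymbol => (δ.top, δ.bottom, δ.lam, δ.mu, δ.t))
    ((hL.prod (hL.prod (hP.prod (hP.prod (Set.finite_Iic n))))).subset ?_) ?_
  · rintro _ ⟨δ, hδ, rfl⟩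
    have hsz : δ.top.sum + δ.bottom.sum + (∑ p ∈ δ.lam, p)
        + (∑ p ∈ δ.mu, p) + (2 * δ.t + 1) ≤ n := hδ
    have h1 := length_le_sum_of_pos _ (fun x hx => (δ.top_parts x hx).1)
    have h2 := length_le_sum_of_pos _ (fun x hx => (δ.bottom_parts x hx).1)
    have h3 : δ.top.length ≤ n := by omega
    have h4 : δ.bottom.length ≤ n := by omega
    refine ⟨⟨h3, fun x hx => ?_⟩, ⟨h4, fun x hx => ?_⟩,
      fun p hp => ?_, fun p hp => ?_, ?_⟩
    · have := (δ.top_parts x hx).2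
      simp only [Set.mem_Iic]; omega
    · have := (δ.bottom_parts x hx).2
      simp only [Set.mem_Iic]; omega
    · have := (δ.lam_parts p hp).2
      simp only [Finset.mem_range]; omega
    · have := (δ.mu_parts p hp).2
      simp only [Finset.mem_range]; omega
    · simp only [Set.mem_Iic]; omega
  · intro δ _ ε _ h
    simp only [Prod.mk.injEq] at h
    exact OddDurfeeSymbol.ext h.1 h.2.1 h.2.2.1 h.2.2.2.1 h.2.2.2.2

theorem finite_oddDurfeeSymbolSet (r s : ℕ) (m : ℤ) (n : ℕ) :
    (oddDurfeeSymbolSet r s m n).Finite :=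
  (finite_oddDurfeeSymbol n).subset fun _ h => h.1.le

theorem finite_markedOddDurfeeSymbolSet (k r s n : ℕ) :
    (markedOddDurfeeSymbolSet k r s n).Finite :=
  (finite_markedOddDurfeeSymbol k n).subset fun _ h => h.1.le

theorem finite_support_oddDurfeeCount (r s n : ℕ) :
    (Function.support fun m : ℤ => oddDurfeeCount r s m n).Finite := by
  refine ((finite_oddDurfeeSymbol n).image OddDurfeeSymbol.rank).subset ?_
  intro m hm
  obtain ⟨δ, hδ⟩ := Set.nonempty_of_ncard_ne_zero (s := oddDurfeeSymbolSet r s m n) hm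
  exact ⟨δ, hδ.1.le, hδ.2.2.2⟩

/-! The subscripts λ, μ, t enter both sides in the same way, and the missing-number conditions
depend on them alone. So fix them and compare rows only. With N = t + 1, let A(N,k) be the
generating function in q, by total, of pairs of rows of odd parts below 2N, each weighted by
binom(rank + k, 2k). Let B(N,k) count the marked pairs with colours 1, …, k + 1. The claim is A = B
(`rowPairMoment_eq_card`).

Put y = q^(2N+1). Both families satisfy (1 - y)² F(N+1,k+1) = F(N,k+1) + y F(N+1,k) and (1 - y)²
F(N+1,0) = F(N,0). For A, inclusion-exclusion removes the parts 2N + 1 (`sum_remove_heads`); a part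
put in one row shifts the rank by ±1, and the second difference of binom(·, 2k+2) is a binom(·, 2k),
which gives the extra term (`rowPairMoment_succ`).

For B, the entry 2N + 1 of the last colour is unrestricted in either row, so (1 - y)² counts the
pairs without it. Such a pair either has no part 2N + 1 at all, or its top row starts with 2N + 1 in
the last but one colour. In the second case the interval of the last colour shrinks to the point 2N
+ 1, so that colour is unused; deleting the entry leaves a marked pair with one colour fewer
(`card_markedRowPairs_filter_succ`).

The recursion, the case N = 0 and vanishing at negative totals determine F
(`eq_of_second_order_recursion`). Totals are integers so that they may be lowered freely. -/

/-! ### Inclusion-exclusion, finiteness, binomials and uniqueness for the recursion -/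

open Finset in
/-- Inclusion-exclusion for removing a fixed first entry `h` of weight `y` from both rows. -/
theorem sum_remove_heads {α : Type*} [DecidableEq α] (D : ℤ → Finset (List α × List α))
    (h : α) (y : ℤ)
    (htop : ∀ S T B, (h :: T, B) ∈ D S ↔ (T, B) ∈ D (S - y))
    (hbot : ∀ S T B, (T, h :: B) ∈ D S ↔ (T, B) ∈ D (S - y))
    (w : List α × List α → ℤ) (S : ℤ) :
    ∑ p ∈ D S with p.1.head? ≠ some h ∧ p.2.head? ≠ some h, w p =
      ∑ p ∈ D S, w p - ∑ p ∈ D (S - y), w (h :: p.1, p.2) - ∑ p ∈ D (S - y), w (p.1, h :: p.2)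
        + ∑ p ∈ D (S - 2 * y), w (h :: p.1, h :: p.2) := by
  have top : ∀ (S : ℤ) (w : List α × List α → ℤ),
      ∑ p ∈ D S with p.1.head? = some h, w p = ∑ p ∈ D (S - y), w (h :: p.1, p.2) := by
    intro S w
    refine Finset.sum_nbij' (fun p => (p.1.tail, p.2)) (fun p => (h :: p.1, p.2)) ?_ ?_ ?_ ?_ ?_
    · rintro ⟨T, B⟩ hp
      rcases T with _ | ⟨a, T⟩ <;> simp at hp
      obtain ⟨hp, rfl⟩ := hp
      exact (htop _ _ _).1 hp
    · rintro ⟨T, B⟩ hp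
      simpa using (htop _ _ _).2 hp
    · rintro ⟨T, B⟩ hp
      rcases T with _ | ⟨a, T⟩ <;> simp at hp
      simp [hp.2]
    · rintro ⟨T, B⟩ hp
      rfl
    · rintro ⟨T, B⟩ hp
      rcases T with _ | ⟨a, T⟩ <;> simp at hp
      simp [hp.2]
  have bot : ∑ p ∈ D S with p.2.head? = some h, w p = ∑ p ∈ D (S - y), w (p.1, h :: p.2) := by
    refine Finset.sum_nbij' (fun p => (p.1, p.2.tail)) (fun p => (p.1, h :: p.2)) ?_ ?_ ?_ ?_ ?_
    · rintro ⟨T, B⟩ hp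
      rcases B with _ | ⟨a, B⟩ <;> simp at hp
      obtain ⟨hp, rfl⟩ := hp
      exact (hbot _ _ _).1 hp
    · rintro ⟨T, B⟩ hp
      simpa using (hbot _ _ _).2 hp
    · rintro ⟨T, B⟩ hp
      rcases B with _ | ⟨a, B⟩ <;> simp at hp
      simp [hp.2]
    · rintro ⟨T, B⟩ hp
      rfl
    · rintro ⟨T, B⟩ hp
      rcases B with _ | ⟨a, B⟩ <;> simp at hp
      simp [hp.2]
  have both : ∑ p ∈ D S with p.1.head? = some h ∧ p.2.head? = some h, w p =
      ∑ p ∈ D (S - 2 * y), w (h :: p.1, h :: p.2) := by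
    refine Finset.sum_nbij' (fun p => (p.1.tail, p.2.tail)) (fun p => (h :: p.1, h :: p.2))
      ?_ ?_ ?_ ?_ ?_
    · rintro ⟨T, B⟩ hp
      rcases T with _ | ⟨a, T⟩ <;> rcases B with _ | ⟨b, B⟩ <;> simp at hp
      obtain ⟨hp, rfl, rfl⟩ := hp
      rw [htop, hbot] at hp
      rwa [show S - 2 * y = S - y - y by ring]
    · rintro ⟨T, B⟩ hp
      rw [show S - 2 * y = S - y - y by ring, ← hbot, ← htop] at hp
      simpa using hp
    · rintro ⟨T, B⟩ hp
      rcases T with _ | ⟨a, T⟩ <;> rcases B with _ | ⟨b, B⟩ <;> simp at hp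
      simp [hp.2]
    · rintro ⟨T, B⟩ hp
      rfl
    · rintro ⟨T, B⟩ hp
      rcases T with _ | ⟨a, T⟩ <;> rcases B with _ | ⟨b, B⟩ <;> simp at hp
      simp [hp.2]
  rw [← top S w, ← bot, ← both]
  simp only [Finset.sum_filter]
  rw [← Finset.sum_sub_distrib, ← Finset.sum_sub_distrib, ← Finset.sum_add_distrib]
  refine Finset.sum_congr rfl fun p _ => ?_
  -- Pointwise this is (1 - a)(1 - b) = 1 - a - b + ab for the indicators a, b of the two head
  -- conditions.
  by_cases h1 : p.1.head? = some h <;> by_cases h2 : p.2.head? = some h <;> simp [h1, h2]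

/-- Odd weights are at least 1, so the total bounds the length of each row. -/
theorem finite_pairs_of_sum_eq {α : Type*} (f : α → ℕ) {A : Set α} (hA : A.Finite)
    (hf : ∀ x ∈ A, Odd (f x)) (S : ℤ) :
    {p : List α × List α | (∀ x ∈ p.1, x ∈ A) ∧ (∀ x ∈ p.2, x ∈ A) ∧
      (((p.1.map f).sum + (p.2.map f).sum : ℕ) : ℤ) = S}.Finite := by
  refine ((finite_lists_of_length_le hA S.toNat).prod
    (finite_lists_of_length_le hA S.toNat)).subset ?_
  rintro ⟨T, B⟩ ⟨hT, hB, hS⟩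
  have h1 := length_le_sum_of_pos (T.map f) (by
    intro x hx
    obtain ⟨e, he, rfl⟩ := List.mem_map.1 hx
    exact hf e (hT e he))
  have h2 := length_le_sum_of_pos (B.map f) (by
    intro x hx
    obtain ⟨e, he, rfl⟩ := List.mem_map.1 hx
    exact hf e (hB e he))
  simp only [List.length_map] at h1 h2 hS
  exact ⟨⟨by simp only; omega, hT⟩, ⟨by simp only; omega, hB⟩⟩

/-- Pascal's rule three times. The lower index drops by two, which is why the 2k-th moments recur in
steps of k. -/
theorem choose_second_difference (x : ℤ) (n : ℕ) :
    Ring.choose (x + 1) (n + 2) + Ring.choose (x - 1) (n + 2) =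
      2 * Ring.choose x (n + 2) + Ring.choose (x - 1) n := by
  have h1 := Ring.choose_succ_succ x (n + 1)
  have h2 := Ring.choose_succ_succ (x - 1) (n + 1)
  have h3 := Ring.choose_succ_succ (x - 1) n
  simp only [sub_add_cancel] at h2 h3
  linarith

/-- Both sides of the main recursion are determined by it. -/
theorem eq_of_second_order_recursion {a b : ℕ → ℕ → ℤ → ℤ}
    (ha0 : ∀ k S, a 0 k S = b 0 k S)
    (hneg : ∀ N k S, S < 0 → a N k S = b N k S)
    (ha : ∀ N S, a N 0 S = a (N + 1) 0 S - 2 * a (N + 1) 0 (S - (2 * N + 1))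
      + a (N + 1) 0 (S - 2 * (2 * N + 1)))
    (hb : ∀ N S, b N 0 S = b (N + 1) 0 S - 2 * b (N + 1) 0 (S - (2 * N + 1))
      + b (N + 1) 0 (S - 2 * (2 * N + 1)))
    (ha' : ∀ N k S, a N (k + 1) S + a (N + 1) k (S - (2 * N + 1)) =
      a (N + 1) (k + 1) S - 2 * a (N + 1) (k + 1) (S - (2 * N + 1))
      + a (N + 1) (k + 1) (S - 2 * (2 * N + 1)))
    (hb' : ∀ N k S, b N (k + 1) S + b (N + 1) k (S - (2 * N + 1)) =
      b (N + 1) (k + 1) S - 2 * b (N + 1) (k + 1) (S - (2 * N + 1))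
      + b (N + 1) (k + 1) (S - 2 * (2 * N + 1))) (N k : ℕ) (S : ℤ) : a N k S = b N k S := by
  induction N generalizing k S with
  | zero => exact ha0 k S
  | succ N ihN =>
    induction k generalizing S with
    | zero =>
      -- Strong induction on the total: both shifts lower S by at least 1, and negative totals are
      -- covered by `hneg`.
      have key : ∀ n : ℕ, ∀ S : ℤ, S < n → a (N + 1) 0 S = b (N + 1) 0 S := by
        intro n
        induction n with
        | zero => exact fun S hS => hneg _ _ _ (by simpa using hS)
        | succ n ih =>
          intro S hS
          push_cast at hS
          have h1 := ih (S - (2 * N + 1)) (by omega)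
          have h2 := ih (S - 2 * (2 * N + 1)) (by omega)
          have := ha N S
          have := hb N S
          have := ihN 0 S
          linarith
      exact key (S.toNat + 1) S (by push_cast; omega)
    | succ k ihk =>
      have key : ∀ n : ℕ, ∀ S : ℤ, S < n → a (N + 1) (k + 1) S = b (N + 1) (k + 1) S := by
        intro n
        induction n with
        | zero => exact fun S hS => hneg _ _ _ (by simpa using hS)
        | succ n ih =>
          intro S hS
          push_cast at hS
          have h1 := ih (S - (2 * N + 1)) (by omega)
          have h2 := ih (S - 2 * (2 * N + 1)) (by omega)
          have := ha' N k S
          have := hb' N k S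
          have := ihN (k + 1) S
          have := ihk (S - (2 * N + 1))
          linarith
      exact key (S.toNat + 1) S (by push_cast; omega)

/-! ### Plain and marked row pairs -/

/-- Two rows of odd parts less than `2N`. -/
structure IsRowPair (N : ℕ) (p : List ℕ × List ℕ) : Prop where
  top_parts : ∀ a ∈ p.1, Odd a ∧ a < 2 * N
  bottom_parts : ∀ a ∈ p.2, Odd a ∧ a < 2 * N
  top_sorted : p.1.Pairwise (fun a b => b ≤ a)
  bottom_sorted : p.2.Pairwise (fun a b => b ≤ a)

/-- Two rows of odd parts less than `2N`, with colours in `{1, …, k + 1}`, obeying the rules for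
marked symbols. -/
structure IsMarkedRowPair (N k : ℕ) (p : List (ℕ × ℕ) × List (ℕ × ℕ)) : Prop where
  top_parts : ∀ e ∈ p.1, Odd e.1 ∧ e.1 < 2 * N ∧ 1 ≤ e.2 ∧ e.2 ≤ k + 1
  bottom_parts : ∀ e ∈ p.2, Odd e.1 ∧ e.1 < 2 * N ∧ 1 ≤ e.2 ∧ e.2 ≤ k + 1
  top_sorted : p.1.Pairwise (fun e f => f.1 ≤ e.1 ∧ f.2 ≤ e.2)
  bottom_sorted : p.2.Pairwise (fun e f => f.1 ≤ e.1 ∧ f.2 ≤ e.2)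
  colour_occurs : ∀ c, 1 ≤ c → c ≤ k → ∃ e ∈ p.1, e.2 = c
  lower : ∀ b ∈ p.2, ∀ e ∈ p.1, e.2 + 1 = b.2 → e.1 ≤ b.1
  upper : ∀ b ∈ p.2, b.2 ≤ k → ∃ e ∈ p.1, e.2 = b.2 ∧ b.1 ≤ e.1

theorem finite_rowPairs (N : ℕ) (S : ℤ) :
    {p : List ℕ × List ℕ | IsRowPair N p ∧ ((p.1.sum + p.2.sum : ℕ) : ℤ) = S}.Finite := by
  refine (finite_pairs_of_sum_eq id (A := {a | Odd a ∧ a < 2 * N})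
    ((Set.finite_Iio (2 * N)).subset fun a h => h.2) (fun a h => h.1) S).subset ?_
  rintro p ⟨hp, hS⟩
  exact ⟨hp.top_parts, hp.bottom_parts, by simpa using hS⟩

theorem finite_markedRowPairs (N k : ℕ) (S : ℤ) :
    {p : List (ℕ × ℕ) × List (ℕ × ℕ) | IsMarkedRowPair N k p ∧
      (((p.1.map Prod.fst).sum + (p.2.map Prod.fst).sum : ℕ) : ℤ) = S}.Finite := by
  refine (finite_pairs_of_sum_eq Prod.fst
    (A := {e | Odd e.1 ∧ e.1 < 2 * N ∧ 1 ≤ e.2 ∧ e.2 ≤ k + 1})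
    (((Set.finite_Iio (2 * N)).prod (Set.finite_Iic (k + 1))).subset
      fun a h => ⟨h.2.1, h.2.2.2⟩) (fun a h => h.1) S).subset ?_
  rintro p ⟨hp, hS⟩
  exact ⟨hp.top_parts, hp.bottom_parts, hS⟩

/-- The row pairs of total `S`. -/
noncomputable def rowPairs (N : ℕ) (S : ℤ) : Finset (List ℕ × List ℕ) :=
  (finite_rowPairs N S).toFinset

/-- The marked row pairs of total `S`. -/
noncomputable def markedRowPairs (N k : ℕ) (S : ℤ) : Finset (List (ℕ × ℕ) × List (ℕ × ℕ)) :=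
  (finite_markedRowPairs N k S).toFinset

theorem mem_rowPairs {N : ℕ} {S : ℤ} {p : List ℕ × List ℕ} :
    p ∈ rowPairs N S ↔ IsRowPair N p ∧ ((p.1.sum + p.2.sum : ℕ) : ℤ) = S := by
  simp [rowPairs]

theorem mem_markedRowPairs {N k : ℕ} {S : ℤ} {p : List (ℕ × ℕ) × List (ℕ × ℕ)} :
    p ∈ markedRowPairs N k S ↔ IsMarkedRowPair N k p ∧
      (((p.1.map Prod.fst).sum + (p.2.map Prod.fst).sum : ℕ) : ℤ) = S := by
  simp [markedRowPairs]

/-- The weight of a row pair in the `2k`-th symmetrized rank moment. -/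
noncomputable def rankWeight (k : ℕ) (p : List ℕ × List ℕ) : ℤ :=
  Ring.choose ((p.1.length : ℤ) - p.2.length + k) (2 * k)

/-- The `2k`-th symmetrized rank moment of row pairs. -/
noncomputable def rowPairMoment (N k : ℕ) (S : ℤ) : ℤ := ∑ p ∈ rowPairs N S, rankWeight k p

/-! ### The recursion for the moments -/

theorem isRowPair_cons_top {N : ℕ} {T B : List ℕ} :
    IsRowPair (N + 1) ((2 * N + 1) :: T, B) ↔ IsRowPair (N + 1) (T, B) := by
  constructor
  · rintro ⟨h1, h2, h3, h4⟩
    exact ⟨fun a ha => h1 a (List.mem_cons_of_mem _ ha), h2, (List.pairwise_cons.1 h3).2, h4⟩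
  · rintro ⟨h1, h2, h3, h4⟩
    refine ⟨?_, h2, List.pairwise_cons.2 ⟨fun a ha => ?_, h3⟩, h4⟩
    · simp only [List.mem_cons, forall_eq_or_imp]
      exact ⟨⟨⟨N, rfl⟩, by omega⟩, h1⟩
    · have := (h1 a ha).2
      omega

theorem IsRowPair.swap {N : ℕ} {T B : List ℕ} (h : IsRowPair N (T, B)) : IsRowPair N (B, T) :=
  ⟨h.2, h.1, h.4, h.3⟩

theorem isRowPair_cons_bottom {N : ℕ} {T B : List ℕ} :
    IsRowPair (N + 1) (T, (2 * N + 1) :: B) ↔ IsRowPair (N + 1) (T, B) :=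
  ⟨fun h => (isRowPair_cons_top.1 h.swap).swap, fun h => (isRowPair_cons_top.2 h.swap).swap⟩

/-- Rows are non-increasing, so the part 2N + 1 is absent as soon as it is not first; by parity all
parts are then below 2N. -/
theorem rowPairs_filter_head (N : ℕ) (S : ℤ) :
    (rowPairs (N + 1) S).filter
      (fun p => p.1.head? ≠ some (2 * N + 1) ∧ p.2.head? ≠ some (2 * N + 1)) = rowPairs N S := by
  have aux : ∀ l : List ℕ, (∀ a ∈ l, Odd a ∧ a < 2 * (N + 1)) → l.Pairwise (fun a b => b ≤ a) →
      l.head? ≠ some (2 * N + 1) → ∀ a ∈ l, Odd a ∧ a < 2 * N := by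
    intro l h1 h2 h3 a ha
    refine ⟨(h1 a ha).1, ?_⟩
    rcases l with _ | ⟨b, l⟩
    · simp at ha
    · have hb : a ≤ b := by
        rcases List.mem_cons.1 ha with rfl | ha
        · rfl
        · exact (List.pairwise_cons.1 h2).1 a ha
      obtain ⟨⟨c, hc⟩, hb2⟩ := h1 b List.mem_cons_self
      simp at h3
      omega
  have aux' : ∀ l : List ℕ, (∀ a ∈ l, Odd a ∧ a < 2 * N) → l.head? ≠ some (2 * N + 1) := by
    intro l h1 h
    have := (h1 _ (List.mem_of_mem_head? h)).2
    omega
  ext p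
  simp only [Finset.mem_filter, mem_rowPairs]
  constructor
  · rintro ⟨⟨h, hS⟩, h1, h2⟩
    exact ⟨⟨aux _ h.1 h.3 h1, aux _ h.2 h.4 h2, h.3, h.4⟩, hS⟩
  · rintro ⟨h, hS⟩
    refine ⟨⟨⟨fun a ha => ?_, fun a ha => ?_, h.3, h.4⟩, hS⟩, aux' _ h.1, aux' _ h.2⟩
    · exact ⟨(h.1 a ha).1, by have := (h.1 a ha).2; omega⟩
    · exact ⟨(h.2 a ha).1, by have := (h.2 a ha).2; omega⟩

theorem sum_rowPairs (N : ℕ) (w : List ℕ × List ℕ → ℤ) (S : ℤ) :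
    ∑ p ∈ rowPairs N S, w p = ∑ p ∈ rowPairs (N + 1) S, w p
      - ∑ p ∈ rowPairs (N + 1) (S - (2 * N + 1)), w ((2 * N + 1) :: p.1, p.2)
      - ∑ p ∈ rowPairs (N + 1) (S - (2 * N + 1)), w (p.1, (2 * N + 1) :: p.2)
      + ∑ p ∈ rowPairs (N + 1) (S - 2 * (2 * N + 1)),
          w ((2 * N + 1) :: p.1, (2 * N + 1) :: p.2) := by
  rw [← rowPairs_filter_head]
  refine sum_remove_heads (rowPairs (N + 1)) (2 * N + 1) (2 * N + 1) ?_ ?_ w S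
  · intro S T B
    rw [mem_rowPairs, mem_rowPairs, isRowPair_cons_top]
    refine and_congr_right fun _ => ?_
    simp only [List.sum_cons]
    push_cast
    constructor <;> intro h <;> linarith
  · intro S T B
    rw [mem_rowPairs, mem_rowPairs, isRowPair_cons_bottom]
    refine and_congr_right fun _ => ?_
    simp only [List.sum_cons]
    push_cast
    constructor <;> intro h <;> linarith

theorem rowPairMoment_zero (N : ℕ) (S : ℤ) :
    rowPairMoment N 0 S = rowPairMoment (N + 1) 0 S
      - 2 * rowPairMoment (N + 1) 0 (S - (2 * N + 1))
      + rowPairMoment (N + 1) 0 (S - 2 * (2 * N + 1)) := by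
  have := sum_rowPairs N (rankWeight 0) S
  simp only [rowPairMoment, rankWeight, mul_zero, Ring.choose_zero_right] at this ⊢
  linarith

/-- A part 2N + 1 in both rows keeps the rank, and in one row moves it by ±1. The two one-row terms
together are governed by `choose_second_difference`. -/
theorem rowPairMoment_succ (N k : ℕ) (S : ℤ) :
    rowPairMoment N (k + 1) S + rowPairMoment (N + 1) k (S - (2 * N + 1)) =
      rowPairMoment (N + 1) (k + 1) S - 2 * rowPairMoment (N + 1) (k + 1) (S - (2 * N + 1))
      + rowPairMoment (N + 1) (k + 1) (S - 2 * (2 * N + 1)) := by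
  have h := sum_rowPairs N (rankWeight (k + 1)) S
  have h1 : ∀ p : List ℕ × List ℕ,
      rankWeight (k + 1) ((2 * N + 1) :: p.1, p.2) + rankWeight (k + 1) (p.1, (2 * N + 1) :: p.2) =
        2 * rankWeight (k + 1) p + rankWeight k p := by
    intro p
    -- With x = rank + (k + 1), the residual argument x - 1 = rank + k is exactly the one centred
    -- for the 2k-th moment.
    have := choose_second_difference ((p.1.length : ℤ) - p.2.length + (k + 1 : ℕ)) (2 * k)
    simp only [rankWeight, List.length_cons]
    convert this using 3 <;> push_cast <;> ring_nf
  have h2 : ∀ p : List ℕ × List ℕ,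
      rankWeight (k + 1) ((2 * N + 1) :: p.1, (2 * N + 1) :: p.2) = rankWeight (k + 1) p := by
    intro p
    simp only [rankWeight, List.length_cons]
    congr 1
    push_cast
    ring
  have h3 := Finset.sum_congr (rfl : rowPairs (N + 1) (S - (2 * N + 1)) = _) fun p _ => h1 p
  simp only [Finset.sum_add_distrib, ← Finset.mul_sum] at h3
  simp only [h2] at h
  simp only [rowPairMoment]
  linarith

/-! ### The recursion for marked row pairs -/

/-- Colours do not increase along the row, so the entry of larger colour stands earlier. -/
theorem List.Pairwise.fst_le_of_snd_lt {l : List (ℕ × ℕ)}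
    (hl : l.Pairwise (fun e f => f.1 ≤ e.1 ∧ f.2 ≤ e.2)) {e f : ℕ × ℕ} (he : e ∈ l) (hf : f ∈ l)
    (hef : e.2 < f.2) : e.1 ≤ f.1 := by
  induction l with
  | nil => simp at he
  | cons a l ih =>
    rw [List.pairwise_cons] at hl
    rcases List.mem_cons.1 he with rfl | he' <;> rcases List.mem_cons.1 hf with rfl | hf'
    · rfl
    · have := (hl.1 f hf').2
      omega
    · exact (hl.1 e he').1
    · exact ih hl.2 he' hf'

/-- The last colour k + 1 need not occur, its top parts are not the upper end of any interval, and
no colour k + 2 exists for which they would be a lower end. -/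
theorem isMarkedRowPair_cons_top {N k : ℕ} {T B : List (ℕ × ℕ)} :
    IsMarkedRowPair (N + 1) k ((2 * N + 1, k + 1) :: T, B) ↔
      IsMarkedRowPair (N + 1) k (T, B) := by
  constructor
  · intro h
    refine ⟨fun a ha => h.1 a (List.mem_cons_of_mem _ ha), h.2, (List.pairwise_cons.1 h.3).2, h.4,
      fun c h1 h2 => ?_, fun b hb e he => h.6 b hb e (List.mem_cons_of_mem _ he), fun b hb hk => ?_⟩
    · obtain ⟨e, he, rfl⟩ := h.5 c h1 h2
      rcases List.mem_cons.1 he with rfl | he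
      · simp only at h2
        omega
      · exact ⟨e, he, rfl⟩
    · obtain ⟨e, he, h1, h2⟩ := h.7 b hb hk
      rcases List.mem_cons.1 he with rfl | he
      · simp only at h1
        omega
      · exact ⟨e, he, h1, h2⟩
  · intro h
    refine ⟨?_, h.2, List.pairwise_cons.2 ⟨fun a ha => ?_, h.3⟩, h.4,
      fun c h1 h2 => ?_, fun b hb e he hbe => ?_, fun b hb hk => ?_⟩
    · intro e he
      rcases List.mem_cons.1 he with rfl | he
      · exact ⟨⟨N, rfl⟩, by simp only; omega, by simp only; omega, le_rfl⟩
      · exact h.1 e he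
    · have := h.1 a ha
      exact ⟨by simp only; omega, this.2.2.2⟩
    · obtain ⟨e, he, h3⟩ := h.5 c h1 h2
      exact ⟨e, List.mem_cons_of_mem _ he, h3⟩
    · rcases List.mem_cons.1 he with rfl | he
      · have := (h.2 b hb).2.2.2
        simp only at hbe
        omega
      · exact h.6 b hb e he hbe
    · obtain ⟨e, he, h3⟩ := h.7 b hb hk
      exact ⟨e, List.mem_cons_of_mem _ he, h3⟩

/-- The largest possible part meets every lower bound, and the last colour has no upper bound coming
from the top row. -/
theorem isMarkedRowPair_cons_bottom {N k : ℕ} {T B : List (ℕ × ℕ)} :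
    IsMarkedRowPair (N + 1) k (T, (2 * N + 1, k + 1) :: B) ↔
      IsMarkedRowPair (N + 1) k (T, B) := by
  constructor
  · intro h
    exact ⟨h.1, fun a ha => h.2 a (List.mem_cons_of_mem _ ha), h.3, (List.pairwise_cons.1 h.4).2,
      h.5, fun b hb => h.6 b (List.mem_cons_of_mem _ hb),
      fun b hb => h.7 b (List.mem_cons_of_mem _ hb)⟩
  · intro h
    refine ⟨h.1, ?_, h.3, List.pairwise_cons.2 ⟨fun a ha => ?_, h.4⟩, h.5,
      fun b hb e he hbe => ?_, fun b hb hk => ?_⟩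
    · intro e he
      rcases List.mem_cons.1 he with rfl | he
      · exact ⟨⟨N, rfl⟩, by simp only; omega, by simp only; omega, le_rfl⟩
      · exact h.2 e he
    · have := h.2 a ha
      exact ⟨by simp only; omega, this.2.2.2⟩
    · rcases List.mem_cons.1 hb with rfl | hb
      · have := (h.1 e he).2.1
        simp only
        omega
      · exact h.6 b hb e he hbe
    · rcases List.mem_cons.1 hb with rfl | hb
      · simp only at hk
        omega
      · exact h.7 b hb hk

/-- The largest admissible entry of a weakly decreasing coloured row can only stand first. -/
theorem head?_eq_of_mem_of_forall_le {l : List (ℕ × ℕ)} {h : ℕ × ℕ}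
    (hl : l.Pairwise (fun e f => f.1 ≤ e.1 ∧ f.2 ≤ e.2))
    (hh : ∀ e ∈ l, e.1 ≤ h.1 ∧ e.2 ≤ h.2) (hm : h ∈ l) : l.head? = some h := by
  rcases l with _ | ⟨a, l⟩
  · simp at hm
  · rcases List.mem_cons.1 hm with rfl | hm
    · rfl
    · have h1 := (List.pairwise_cons.1 hl).1 h hm
      have h2 := hh a List.mem_cons_self
      simp only [List.head?_cons, Option.some.injEq]
      exact Prod.ext (le_antisymm h2.1 h1.1) (le_antisymm h2.2 h1.2)

theorem IsMarkedRowPair.notMem_of_head? {N k : ℕ} {p : List (ℕ × ℕ) × List (ℕ × ℕ)}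
    (h : IsMarkedRowPair (N + 1) k p) (h1 : p.1.head? ≠ some (2 * N + 1, k + 1))
    (h2 : p.2.head? ≠ some (2 * N + 1, k + 1)) :
    (2 * N + 1, k + 1) ∉ p.1 ∧ (2 * N + 1, k + 1) ∉ p.2 := by
  refine ⟨fun hm => h1 (head?_eq_of_mem_of_forall_le h.3 (fun e he => ?_) hm),
    fun hm => h2 (head?_eq_of_mem_of_forall_le h.4 (fun e he => ?_) hm)⟩
  · have := h.1 e he
    exact ⟨by simp only; omega, this.2.2.2⟩
  · have := h.2 e he
    exact ⟨by simp only; omega, this.2.2.2⟩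

/-- If the largest part `2N + 1` occurs neither with the top colour nor, in the top row, with the
colour before it, then it does not occur at all. -/
theorem IsMarkedRowPair.of_notMem {N k : ℕ} {p : List (ℕ × ℕ) × List (ℕ × ℕ)}
    (h : IsMarkedRowPair (N + 1) k p) (h1 : (2 * N + 1, k + 1) ∉ p.1)
    (h2 : (2 * N + 1, k + 1) ∉ p.2) (h3 : (2 * N + 1, k) ∉ p.1) : IsMarkedRowPair N k p := by
  have top : ∀ e ∈ p.1, e.1 ≠ 2 * N + 1 := by
    rintro ⟨x, c⟩ he rfl
    have hc := (h.1 _ he).2.2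
    simp only at hc
    rcases Nat.lt_or_ge c k with hck | hck
    -- A top part 2N + 1 of colour below k forces the obligatory colour k to contain 2N + 1 as well,
    -- which `h3` excludes.
    · obtain ⟨⟨x, c'⟩, he', rfl⟩ := h.5 k (by omega) le_rfl
      simp only at hck h3 hc
      have hx := (h.1 _ he').2.1
      simp only at hx
      have hle : 2 * N + 1 ≤ x := h.3.fst_le_of_snd_lt he he' hck
      obtain rfl : x = 2 * N + 1 := by omega
      exact h3 he'
    · rcases Nat.eq_or_lt_of_le hck with rfl | hck
      · exact h3 he
      · obtain rfl : c = k + 1 := by omega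
        exact h1 he
  have lt : ∀ x, Odd x → x < 2 * (N + 1) → x ≠ 2 * N + 1 → x < 2 * N := by
    rintro x ⟨y, rfl⟩ h4 h5
    omega
  refine ⟨fun e he => ?_, fun e he => ?_, h.3, h.4, h.5, h.6, h.7⟩
  · have := h.1 e he
    exact ⟨this.1, lt _ this.1 this.2.1 (top e he), this.2.2⟩
  · have := h.2 e he
    refine ⟨this.1, lt _ this.1 this.2.1 fun hx => ?_, this.2.2⟩
    rcases Nat.lt_or_ge k e.2 with hk | hk
    · obtain ⟨x, c⟩ := e
      simp only at hx hk this
      obtain rfl : c = k + 1 := by omega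
      exact h2 (hx ▸ he)
    -- A bottom part of a colour at most k lies below a top part of that colour, so 2N + 1 would
    -- reappear in the top row.
    · obtain ⟨f, hf, -, hle⟩ := h.7 e he hk
      have := (h.1 f hf).2.1
      exact top f hf (by omega)

theorem IsMarkedRowPair.succ {N k : ℕ} {p : List (ℕ × ℕ) × List (ℕ × ℕ)}
    (h : IsMarkedRowPair N k p) : IsMarkedRowPair (N + 1) k p := by
  refine ⟨fun e he => ?_, fun e he => ?_, h.3, h.4, h.5, h.6, h.7⟩
  · have := h.1 e he
    exact ⟨this.1, by omega, this.2.2⟩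
  · have := h.2 e he
    exact ⟨this.1, by omega, this.2.2⟩

theorem IsMarkedRowPair.head?_ne {N k c : ℕ} {p : List (ℕ × ℕ) × List (ℕ × ℕ)}
    (h : IsMarkedRowPair N k p) :
    p.1.head? ≠ some (2 * N + 1, c) ∧ p.2.head? ≠ some (2 * N + 1, c) := by
  constructor <;> intro hm
  · have := (h.1 _ (List.mem_of_mem_head? hm)).2.1
    simp only at this
    omega
  · have := (h.2 _ (List.mem_of_mem_head? hm)).2.1
    simp only at this
    omega

/-- Adding or removing a top entry `2N + 1` of the last but one colour. -/
theorem isMarkedRowPair_cons_succ {N k : ℕ} {T B : List (ℕ × ℕ)} :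
    IsMarkedRowPair (N + 1) (k + 1) ((2 * N + 1, k + 1) :: T, B) ∧ (2 * N + 1, k + 2) ∉ B ↔
      IsMarkedRowPair (N + 1) k (T, B) := by
  constructor
  · rintro ⟨h, hB⟩
    have hT := (List.pairwise_cons.1 h.3).1
    have hB' : ∀ b ∈ B, b.2 ≤ k + 1 := by
      rintro ⟨x, c⟩ hb
      by_contra hc
      have h1 := h.2 _ hb
      simp only at h1 hc
      obtain rfl : c = k + 2 := by omega
      -- The new top entry raises the lower end for colour k + 2 to 2N + 1, so the excluded entry is
      -- the only possible bottom entry of that colour.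
      have h2 := h.6 _ hb (2 * N + 1, k + 1) List.mem_cons_self rfl
      simp only at h2
      obtain rfl : x = 2 * N + 1 := by omega
      exact hB hb
    refine ⟨fun e he => ?_, fun e he => ?_, (List.pairwise_cons.1 h.3).2, h.4,
      fun c h1 h2 => ?_, fun b hb e he => h.6 b hb e (List.mem_cons_of_mem _ he), fun b hb hk => ?_⟩
    · have := h.1 e (List.mem_cons_of_mem _ he)
      exact ⟨this.1, this.2.1, this.2.2.1, (hT e he).2⟩
    · have := h.2 e he
      exact ⟨this.1, this.2.1, this.2.2.1, hB' e he⟩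
    · obtain ⟨e, he, rfl⟩ := h.5 c h1 (by omega)
      rcases List.mem_cons.1 he with rfl | he
      · simp only at h2
        omega
      · exact ⟨e, he, rfl⟩
    · obtain ⟨e, he, h1, h2⟩ := h.7 b hb (by omega)
      rcases List.mem_cons.1 he with rfl | he
      · simp only at h1
        omega
      · exact ⟨e, he, h1, h2⟩
  · intro h
    refine ⟨⟨fun e he => ?_, fun e he => ?_, List.pairwise_cons.2 ⟨fun a ha => ?_, h.3⟩, h.4,
      fun c h1 h2 => ?_, fun b hb e he hbe => ?_, fun b hb hk => ?_⟩, fun hb => ?_⟩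
    · rcases List.mem_cons.1 he with rfl | he
      · exact ⟨⟨N, rfl⟩, by simp only; omega, by simp only; omega, by simp only; omega⟩
      · have := h.1 e he
        exact ⟨this.1, this.2.1, this.2.2.1, by omega⟩
    · have := h.2 e he
      exact ⟨this.1, this.2.1, this.2.2.1, by omega⟩
    · have := h.1 a ha
      exact ⟨by simp only; omega, this.2.2.2⟩
    · rcases Nat.lt_or_ge k c with hc | hc
      · exact ⟨_, List.mem_cons_self, by simp only; omega⟩
      · obtain ⟨e, he, h3⟩ := h.5 c h1 hc
        exact ⟨e, List.mem_cons_of_mem _ he, h3⟩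
    · rcases List.mem_cons.1 he with rfl | he
      · have := (h.2 b hb).2.2.2
        simp only at hbe
        omega
      · exact h.6 b hb e he hbe
    · rcases Nat.lt_or_ge k b.2 with hc | hc
      · have := (h.2 b hb).2.1
        -- Colour k + 1 was last and is now last but one; the added entry 2N + 1 supplies the upper
        -- end it now needs.
        exact ⟨_, List.mem_cons_self, by simp only; omega, by simp only; omega⟩
      · obtain ⟨e, he, h3⟩ := h.7 b hb hc
        exact ⟨e, List.mem_cons_of_mem _ he, h3⟩
    · have := (h.2 _ hb).2.2.2
      simp only at this
      omega

/-- With a single colour there is no preceding one, so the alternative of a top entry 2N + 1 in the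
last but one colour is void. -/
theorem markedRowPairs_filter_zero (N : ℕ) (S : ℤ) :
    (markedRowPairs (N + 1) 0 S).filter
      (fun p => p.1.head? ≠ some (2 * N + 1, 0 + 1) ∧ p.2.head? ≠ some (2 * N + 1, 0 + 1)) =
      markedRowPairs N 0 S := by
  ext p
  simp only [Finset.mem_filter, mem_markedRowPairs]
  constructor
  · rintro ⟨⟨h, hS⟩, h1, h2⟩
    obtain ⟨h3, h4⟩ := h.notMem_of_head? h1 h2
    refine ⟨h.of_notMem h3 h4 fun h5 => ?_, hS⟩
    have := (h.1 _ h5).2.2.1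
    simp only at this
    omega
  · rintro ⟨h, hS⟩
    exact ⟨⟨h.succ, hS⟩, h.head?_ne⟩

/-- The two terms separate pairs without the part 2N + 1 from pairs whose top row starts with (2N +
1, k + 1). In the latter that entry is deleted and colour k + 1 becomes the last one. -/
theorem card_markedRowPairs_filter_succ (N k : ℕ) (S : ℤ) :
    ((markedRowPairs (N + 1) (k + 1) S).filter
      (fun p => p.1.head? ≠ some (2 * N + 1, k + 1 + 1) ∧
        p.2.head? ≠ some (2 * N + 1, k + 1 + 1))).card =
      (markedRowPairs N (k + 1) S).card + (markedRowPairs (N + 1) k (S - (2 * N + 1))).card := by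
  have hcard : (markedRowPairs (N + 1) k (S - (2 * N + 1))).card =
      ((markedRowPairs (N + 1) k (S - (2 * N + 1))).image
        (fun p => ((2 * N + 1, k + 1) :: p.1, p.2))).card := by
    refine (Finset.card_image_of_injective _ ?_).symm
    rintro ⟨T, B⟩ ⟨T', B'⟩ h
    simpa using h
  rw [hcard, ← Finset.card_union_of_disjoint]
  · congr 1
    ext ⟨T, B⟩
    simp only [Finset.mem_filter, Finset.mem_union, Finset.mem_image, mem_markedRowPairs,
      Prod.exists, Prod.mk.injEq]
    constructor
    · rintro ⟨⟨h, hS⟩, h1, h2⟩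
      obtain ⟨h3, h4⟩ := h.notMem_of_head? h1 h2
      by_cases h5 : (2 * N + 1, k + 1) ∈ T
      · right
        have h6 := head?_eq_of_mem_of_forall_le h.3 (fun e he => ?_) h5
        · rcases T with _ | ⟨a, T⟩
          · simp at h6
          · simp only [List.head?_cons, Option.some.injEq] at h6
            subst h6
            refine ⟨T, B, ⟨isMarkedRowPair_cons_succ.1 ⟨h, h4⟩, ?_⟩, rfl, rfl⟩
            simp only [List.map_cons, List.sum_cons] at hS
            push_cast at hS ⊢
            linarith
        · have h6 := h.1 e he
          refine ⟨by simp only; omega, ?_⟩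
          by_contra hc
          obtain ⟨x, c⟩ := e
          simp only at h6 hc
          obtain rfl : c = k + 1 + 1 := by omega
          -- An entry of colour k + 2 would have part at least 2N + 1 and thus be the excluded
          -- entry; hence (2N + 1, k + 1) is maximal and stands first.
          have := h.3.fst_le_of_snd_lt h5 he (by simp)
          simp only at this
          obtain rfl : x = 2 * N + 1 := by omega
          exact h3 he
      · exact Or.inl ⟨h.of_notMem h3 h4 h5, hS⟩
    · rintro (⟨h, hS⟩ | ⟨T, B, ⟨h, hS⟩, rfl, rfl⟩)
      · exact ⟨⟨h.succ, hS⟩, h.head?_ne⟩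
      · obtain ⟨h1, h2⟩ := isMarkedRowPair_cons_succ.2 h
        refine ⟨⟨h1, ?_⟩, by simp, fun h3 => h2 (List.mem_of_mem_head? h3)⟩
        simp only [List.map_cons, List.sum_cons] at hS ⊢
        push_cast at hS ⊢
        linarith
  · rw [Finset.disjoint_left]
    intro p hp hp'
    obtain ⟨q, -, rfl⟩ := Finset.mem_image.1 hp'
    exact (mem_markedRowPairs.1 hp).1.head?_ne.1 rfl

/-- Inclusion-exclusion with constant weight 1, so the two one-row terms coincide. -/
theorem card_filter_markedRowPairs (N k : ℕ) (S : ℤ) :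
    (((markedRowPairs (N + 1) k S).filter
      (fun p => p.1.head? ≠ some (2 * N + 1, k + 1) ∧
        p.2.head? ≠ some (2 * N + 1, k + 1))).card : ℤ) =
      (markedRowPairs (N + 1) k S).card - 2 * (markedRowPairs (N + 1) k (S - (2 * N + 1))).card
      + (markedRowPairs (N + 1) k (S - 2 * (2 * N + 1))).card := by
  have h := sum_remove_heads (markedRowPairs (N + 1) k) (2 * N + 1, k + 1) (2 * N + 1)
    ?_ ?_ (fun _ => 1) S
  · simp only [Finset.sum_const, nsmul_eq_mul, mul_one] at h
    linarith
  · intro S T B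
    rw [mem_markedRowPairs, mem_markedRowPairs, isMarkedRowPair_cons_top]
    refine and_congr_right fun _ => ?_
    simp only [List.map_cons, List.sum_cons]
    push_cast
    constructor <;> intro h <;> linarith
  · intro S T B
    rw [mem_markedRowPairs, mem_markedRowPairs, isMarkedRowPair_cons_bottom]
    refine and_congr_right fun _ => ?_
    simp only [List.map_cons, List.sum_cons]
    push_cast
    constructor <;> intro h <;> linarith

/-! ### The case of empty rows, and equality of the two families -/

theorem mem_rowPairs_zero {S : ℤ} {p : List ℕ × List ℕ} :
    p ∈ rowPairs 0 S ↔ p = ([], []) ∧ S = 0 := by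
  rw [mem_rowPairs]
  constructor
  · rintro ⟨h, hS⟩
    have h1 : p.1 = [] := List.eq_nil_iff_forall_not_mem.2 fun a ha => by
      have := (h.1 a ha).2
      omega
    have h2 : p.2 = [] := List.eq_nil_iff_forall_not_mem.2 fun a ha => by
      have := (h.2 a ha).2
      omega
    rw [h1, h2] at hS
    exact ⟨Prod.ext h1 h2, by simpa using hS.symm⟩
  · rintro ⟨rfl, rfl⟩
    exact ⟨by constructor <;> simp, rfl⟩

theorem mem_markedRowPairs_zero {k : ℕ} {S : ℤ} {p : List (ℕ × ℕ) × List (ℕ × ℕ)} :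
    p ∈ markedRowPairs 0 k S ↔ p = ([], []) ∧ S = 0 ∧ k = 0 := by
  rw [mem_markedRowPairs]
  constructor
  · rintro ⟨h, hS⟩
    have h1 : p.1 = [] := List.eq_nil_iff_forall_not_mem.2 fun a ha => by
      have := (h.1 a ha).2
      omega
    have h2 : p.2 = [] := List.eq_nil_iff_forall_not_mem.2 fun a ha => by
      have := (h.2 a ha).2
      omega
    refine ⟨Prod.ext h1 h2, by simpa [h1, h2] using hS.symm, ?_⟩
    by_contra hk
    obtain ⟨e, he, -⟩ := h.5 1 le_rfl (by omega)
    simp [h1] at he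
  · rintro ⟨rfl, rfl, rfl⟩
    exact ⟨by constructor <;> (simp; try omega), rfl⟩

/-- Only the empty pair remains. Its weight binom(k, 2k) is 1 for k = 0 and 0 otherwise; likewise it
can be marked only for k = 0, since otherwise colour 1 must occur. -/
theorem rowPairMoment_eq_card_zero (k : ℕ) (S : ℤ) :
    rowPairMoment 0 k S = (markedRowPairs 0 k S).card := by
  by_cases hS : S = 0
  · have h1 : rowPairs 0 S = {([], [])} := by
      ext p
      simp [mem_rowPairs_zero, hS]
    have h2 : rowPairMoment 0 k S = (k.choose (2 * k) : ℕ) := by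
      rw [rowPairMoment, h1, Finset.sum_singleton, rankWeight]
      simpa using Ring.choose_natCast (R := ℤ) k (2 * k)
    rw [h2]
    rcases Nat.eq_zero_or_pos k with rfl | hk
    · have h3 : markedRowPairs 0 0 S = {([], [])} := by
        ext p
        simp [mem_markedRowPairs_zero, hS]
      simp [h3]
    · have h3 : markedRowPairs 0 k S = ∅ := by
        ext p
        simp [mem_markedRowPairs_zero, hS]
        omega
      rw [h3, Nat.choose_eq_zero_of_lt (by omega)]
      rfl
  · have h1 : rowPairs 0 S = ∅ := by
      ext p
      simp [mem_rowPairs_zero, hS]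
    have h2 : markedRowPairs 0 k S = ∅ := by
      ext p
      simp [mem_markedRowPairs_zero, hS]
    simp [rowPairMoment, h1, h2]

/-- The symmetrized rank moment of row pairs counts marked row pairs. -/
theorem rowPairMoment_eq_card (N k : ℕ) (S : ℤ) :
    rowPairMoment N k S = (markedRowPairs N k S).card := by
  refine eq_of_second_order_recursion (a := rowPairMoment)
    (b := fun N k S => (markedRowPairs N k S).card) rowPairMoment_eq_card_zero ?_
    rowPairMoment_zero ?_ rowPairMoment_succ ?_ N k S
  · intro N k S hS
    have h1 : rowPairs N S = ∅ := by
      refine Finset.eq_empty_of_forall_notMem fun p hp => ?_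
      have := (mem_rowPairs.1 hp).2
      omega
    have h2 : markedRowPairs N k S = ∅ := by
      refine Finset.eq_empty_of_forall_notMem fun p hp => ?_
      have := (mem_markedRowPairs.1 hp).2
      omega
    simp [rowPairMoment, h1, h2]
  · intro N S
    have := card_filter_markedRowPairs N 0 S
    rwa [markedRowPairs_filter_zero] at this
  · intro N k S
    have := card_filter_markedRowPairs N (k + 1) S
    rw [card_markedRowPairs_filter_succ] at this
    push_cast at this
    exact this

/-! ### From symbols to row pairs -/

theorem largestOfColour_le_iff {row : List (ℕ × ℕ)} {c x : ℕ} :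
    largestOfColour row c ≤ x ↔ ∀ e ∈ row, e.2 = c → e.1 ≤ x := by
  induction row with
  | nil => simp [largestOfColour]
  | cons a l ih =>
    by_cases h : a.2 = c
    · simp only [largestOfColour] at ih ⊢
      simp [h, ih]
    · simp only [largestOfColour] at ih ⊢
      simp [h, ih]

/-- Positivity of x rules out the default value 0 that `largestOfColour` takes on an absent colour.
-/
theorem le_largestOfColour_iff {row : List (ℕ × ℕ)} {c x : ℕ} (hx : 0 < x) :
    x ≤ largestOfColour row c ↔ ∃ e ∈ row, e.2 = c ∧ x ≤ e.1 := by
  have h := largestOfColour_le_iff (row := row) (c := c) (x := x - 1)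
  rw [← not_iff_not]
  push Not
  have h1 : largestOfColour row c < x ↔ largestOfColour row c ≤ x - 1 := by omega
  rw [h1, h]
  refine forall₂_congr fun e _ => forall_congr' fun _ => ?_
  omega

/-- For c = 1 both sides hold: the left endpoint is 1, and no top entry has colour 0. -/
theorem lowerEnd_le_iff {top : List (ℕ × ℕ)} {c x : ℕ} (hc : 1 ≤ c) (hx : 0 < x)
    (htop : ∀ e ∈ top, 1 ≤ e.2) :
    lowerEnd top c ≤ x ↔ ∀ e ∈ top, e.2 + 1 = c → e.1 ≤ x := by
  unfold lowerEnd
  split_ifs with h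
  · subst h
    refine ⟨fun _ e he h => ?_, fun _ => hx⟩
    have := htop e he
    omega
  · rw [largestOfColour_le_iff]
    refine forall₂_congr fun e _ => ?_
    rw [show e.2 = c - 1 ↔ e.2 + 1 = c by omega]

theorem MarkedOddDurfeeSymbol.isMarkedRowPair {k : ℕ} (δ : MarkedOddDurfeeSymbol (k + 1)) :
    IsMarkedRowPair (δ.t + 1) k (δ.top, δ.bottom) := by
  refine ⟨fun e he => ?_, fun e he => ?_, δ.top_sorted, δ.bottom_sorted,
    fun c h1 h2 => δ.colour_occurs c h1 (by omega), fun b hb => ?_, fun b hb hk => ?_⟩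
  · have h1 := δ.top_parts e he
    have h2 := δ.top_colours e he
    exact ⟨h1.1, by omega, h2⟩
  · have h1 := δ.bottom_parts e he
    have h2 := δ.bottom_colours e he
    exact ⟨h1.1, by omega, h2⟩
  · exact (lowerEnd_le_iff (δ.bottom_colours b hb).1 (δ.bottom_parts b hb).1.pos
      fun e he => (δ.top_colours e he).1).1 (δ.bottom_interval b hb).1
  · have h := (δ.bottom_interval b hb).2
    rw [upperEnd, if_neg (by omega)] at h
    exact (le_largestOfColour_iff (δ.bottom_parts b hb).1.pos).1 h

/-- The marked symbol with given rows and subscripts. -/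
def IsMarkedRowPair.toMarkedSymbol {t k : ℕ} {p : List (ℕ × ℕ) × List (ℕ × ℕ)}
    (h : IsMarkedRowPair (t + 1) k p) (lam mu : Finset ℕ)
    (hlam : ∀ p ∈ lam, Odd p ∧ p + 1 ≤ 2 * t) (hmu : ∀ p ∈ mu, Odd p ∧ p + 1 ≤ 2 * t) :
    MarkedOddDurfeeSymbol (k + 1) where
  top := p.1
  bottom := p.2
  lam := lam
  mu := mu
  t := t
  top_parts e he := ⟨(h.1 e he).1, by have := (h.1 e he).2.1; omega⟩
  bottom_parts e he := ⟨(h.2 e he).1, by have := (h.2 e he).2.1; omega⟩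
  lam_parts := hlam
  mu_parts := hmu
  top_colours e he := (h.1 e he).2.2
  bottom_colours e he := (h.2 e he).2.2
  top_sorted := h.3
  bottom_sorted := h.4
  colour_occurs c h1 h2 := h.5 c h1 (by omega)
  bottom_interval b hb := by
    have hb' := h.2 b hb
    refine ⟨(lowerEnd_le_iff hb'.2.2.1 hb'.1.pos fun e he => (h.1 e he).2.2.1).2 (h.6 b hb), ?_⟩
    unfold upperEnd
    split_ifs with hk
    · omega
    · exact (le_largestOfColour_iff hb'.1.pos).2 (h.7 b hb (by omega))

theorem OddDurfeeSymbol.isRowPair (δ : OddDurfeeSymbol) :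
    IsRowPair (δ.t + 1) (δ.top, δ.bottom) := by
  refine ⟨fun e he => ?_, fun e he => ?_, δ.top_sorted, δ.bottom_sorted⟩
  · have h1 := δ.top_parts e he
    exact ⟨h1.1, by omega⟩
  · have h1 := δ.bottom_parts e he
    exact ⟨h1.1, by omega⟩

/-- The symbol with given rows and subscripts. -/
def IsRowPair.toSymbol {t : ℕ} {p : List ℕ × List ℕ}
    (h : IsRowPair (t + 1) p) (lam mu : Finset ℕ)
    (hlam : ∀ p ∈ lam, Odd p ∧ p + 1 ≤ 2 * t) (hmu : ∀ p ∈ mu, Odd p ∧ p + 1 ≤ 2 * t) :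
    OddDurfeeSymbol where
  top := p.1
  bottom := p.2
  lam := lam
  mu := mu
  t := t
  top_parts e he := ⟨(h.1 e he).1, by have := (h.1 e he).2; omega⟩
  bottom_parts e he := ⟨(h.2 e he).1, by have := (h.2 e he).2; omega⟩
  lam_parts := hlam
  mu_parts := hmu
  top_sorted := h.3
  bottom_sorted := h.4

/-! ### Sorting symbols by their subscripts -/

/-- The subscripts `(lam, mu, t)` of a symbol. -/
def OddDurfeeSymbol.subscripts (δ : OddDurfeeSymbol) : Finset ℕ × Finset ℕ × ℕ :=
  (δ.lam, δ.mu, δ.t)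

/-- Admissible subscripts with `r` and `s` missing parts. -/
structure IsSubscripts (r s : ℕ) (z : Finset ℕ × Finset ℕ × ℕ) : Prop where
  lam_parts : ∀ p ∈ z.1, Odd p ∧ p + 1 ≤ 2 * z.2.2
  mu_parts : ∀ p ∈ z.2.1, Odd p ∧ p + 1 ≤ 2 * z.2.2
  missing_lam : OddDurfeeSymbol.missing z.2.2 z.1 = r
  missing_mu : OddDurfeeSymbol.missing z.2.2 z.2.1 = s

/-- What the subscripts leave of `n` for the two rows. -/
def rowTotal (n : ℕ) (z : Finset ℕ × Finset ℕ × ℕ) : ℤ :=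
  n - ((∑ p ∈ z.1, p) + (∑ p ∈ z.2.1, p) + (2 * z.2.2 + 1) : ℕ)

theorem finite_symbols (r s n : ℕ) : {δ : OddDurfeeSymbol | δ.size = n ∧
    OddDurfeeSymbol.missing δ.t δ.lam = r ∧ OddDurfeeSymbol.missing δ.t δ.mu = s}.Finite :=
  (finite_oddDurfeeSymbol n).subset fun _ h => h.1.le

/-- The symbols for `n` with `r` and `s` missing parts. -/
noncomputable def symbols (r s n : ℕ) : Finset OddDurfeeSymbol :=
  (finite_symbols r s n).toFinset

/-- The `(k + 1)`-marked symbols for `n` with `r` and `s` missing parts. -/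
noncomputable def markedSymbols (k r s n : ℕ) : Finset (MarkedOddDurfeeSymbol (k + 1)) :=
  (finite_markedOddDurfeeSymbolSet (k + 1) r s n).toFinset

theorem mem_symbols {r s n : ℕ} {δ : OddDurfeeSymbol} : δ ∈ symbols r s n ↔ δ.size = n ∧
    OddDurfeeSymbol.missing δ.t δ.lam = r ∧ OddDurfeeSymbol.missing δ.t δ.mu = s := by
  simp [symbols]

theorem mem_markedSymbols {k r s n : ℕ} {δ : MarkedOddDurfeeSymbol (k + 1)} :
    δ ∈ markedSymbols k r s n ↔ δ.toSymbol.size = n ∧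
    OddDurfeeSymbol.missing δ.t δ.lam = r ∧ OddDurfeeSymbol.missing δ.t δ.mu = s := by
  simp [markedSymbols, markedOddDurfeeSymbolSet]

/-- Grouping the symbols by rank turns the sum over ranks into a sum over symbols; ranks that do not
occur contribute nothing. -/
theorem symmetrizedOddRankMoment_eq_sum (k r s n : ℕ) :
    symmetrizedOddRankMoment (2 * k) r s n =
      ∑ δ ∈ symbols r s n, rankWeight k (δ.top, δ.bottom) := by
  classical
  have hcount : ∀ m : ℤ, oddDurfeeCount r s m n =
      ((symbols r s n).filter (fun δ => δ.rank = m)).card := by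
    intro m
    rw [oddDurfeeCount, ← Set.ncard_coe_finset]
    congr 1
    ext δ
    simp [oddDurfeeSymbolSet, mem_symbols, and_assoc]
  have hsum := Finset.sum_comp (s := symbols r s n)
    (fun m : ℤ => Ring.choose (m + k) (2 * k)) OddDurfeeSymbol.rank
  change ∑ δ ∈ symbols r s n, rankWeight k (δ.top, δ.bottom) = _ at hsum
  rw [hsum, symmetrizedOddRankMoment, finsum_eq_sum_of_support_subset (s :=
    (symbols r s n).image OddDurfeeSymbol.rank)]
  · refine Finset.sum_congr rfl fun m _ => ?_
    rw [hcount, Nat.mul_div_cancel_left k two_pos, nsmul_eq_mul, mul_comm]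
  · intro m hm
    have h1 : oddDurfeeCount r s m n ≠ 0 := fun h0 => hm (by simp [h0])
    rw [hcount, Finset.card_ne_zero] at h1
    obtain ⟨δ, hδ⟩ := h1
    rw [Finset.mem_filter] at hδ
    exact Finset.mem_coe.2 (Finset.mem_image.2 ⟨δ, hδ⟩)

theorem markedOddDurfeeCount_eq_card (k r s n : ℕ) :
    markedOddDurfeeCount (k + 1) r s n = (markedSymbols k r s n).card := by
  exact Set.ncard_eq_toFinset_card _ (finite_markedOddDurfeeSymbolSet (k + 1) r s n)

theorem sum_symbols_filter_subscripts {r s : ℕ} (k n : ℕ) {z : Finset ℕ × Finset ℕ × ℕ}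
    (hz : IsSubscripts r s z) :
    ∑ δ ∈ symbols r s n with δ.subscripts = z, rankWeight k (δ.top, δ.bottom) =
      rowPairMoment (z.2.2 + 1) k (rowTotal n z) := by
  refine Finset.sum_bij' (fun δ _ => (δ.top, δ.bottom))
    (fun p hp => (mem_rowPairs.1 hp).1.toSymbol z.1 z.2.1 hz.1 hz.2) ?_ ?_ ?_ ?_ ?_
  · intro δ hδ
    obtain ⟨h, rfl⟩ := Finset.mem_filter.1 hδ
    have h1 := (mem_symbols.1 h).1
    refine mem_rowPairs.2 ⟨δ.isRowPair, ?_⟩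
    simp only [OddDurfeeSymbol.size] at h1
    simp only [rowTotal, OddDurfeeSymbol.subscripts]
    omega
  · intro p hp
    refine Finset.mem_filter.2 ⟨mem_symbols.2 ⟨?_, hz.3, hz.4⟩, rfl⟩
    have h1 := (mem_rowPairs.1 hp).2
    simp only [rowTotal] at h1
    simp only [OddDurfeeSymbol.size, IsRowPair.toSymbol]
    omega
  · intro δ hδ
    obtain ⟨h, rfl⟩ := Finset.mem_filter.1 hδ
    rfl
  · intro p hp
    rfl
  · intro p hp
    rfl

theorem card_markedSymbols_filter_subscripts {r s : ℕ} (k n : ℕ) {z : Finset ℕ × Finset ℕ × ℕ}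
    (hz : IsSubscripts r s z) :
    ((markedSymbols k r s n).filter (fun δ => δ.toSymbol.subscripts = z)).card =
      (markedRowPairs (z.2.2 + 1) k (rowTotal n z)).card := by
  refine Finset.card_bij' (fun δ _ => (δ.top, δ.bottom))
    (fun p hp => (mem_markedRowPairs.1 hp).1.toMarkedSymbol z.1 z.2.1 hz.1 hz.2) ?_ ?_ ?_ ?_
  · intro δ hδ
    obtain ⟨h, rfl⟩ := Finset.mem_filter.1 hδ
    have h1 := (mem_markedSymbols.1 h).1
    refine mem_markedRowPairs.2 ⟨δ.isMarkedRowPair, ?_⟩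
    simp only [OddDurfeeSymbol.size, MarkedOddDurfeeSymbol.toSymbol] at h1
    simp only [rowTotal, OddDurfeeSymbol.subscripts, MarkedOddDurfeeSymbol.toSymbol]
    omega
  · intro p hp
    refine Finset.mem_filter.2 ⟨mem_markedSymbols.2 ⟨?_, hz.3, hz.4⟩, rfl⟩
    have h1 := (mem_markedRowPairs.1 hp).2
    simp only [rowTotal] at h1
    simp only [OddDurfeeSymbol.size, MarkedOddDurfeeSymbol.toSymbol,
      IsMarkedRowPair.toMarkedSymbol]
    omega
  · intro δ hδ
    obtain ⟨h, rfl⟩ := Finset.mem_filter.1 hδ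
    rfl
  · intro p hp
    rfl

theorem mainTheorem9 (k : ℕ) (hk : 1 ≤ k) (r s n : ℕ) :
    symmetrizedOddRankMoment (2 * k) r s n = (markedOddDurfeeCount (k + 1) r s n : ℤ) := by
  classical
  rw [symmetrizedOddRankMoment_eq_sum, markedOddDurfeeCount_eq_card]
  -- Both sums are fibred over one finite set, so it collects the subscripts of both kinds of
  -- symbol; a fibre may be empty on either side.
  let Z := (symbols r s n).image OddDurfeeSymbol.subscripts ∪
    (markedSymbols k r s n).image (fun δ => δ.toSymbol.subscripts)
  have hZ : ∀ z ∈ Z, IsSubscripts r s z := by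
    intro z hz
    rcases Finset.mem_union.1 hz with hz | hz
    · obtain ⟨δ, hδ, rfl⟩ := Finset.mem_image.1 hz
      exact ⟨δ.lam_parts, δ.mu_parts, (mem_symbols.1 hδ).2.1, (mem_symbols.1 hδ).2.2⟩
    · obtain ⟨δ, hδ, rfl⟩ := Finset.mem_image.1 hz
      exact ⟨δ.lam_parts, δ.mu_parts, (mem_markedSymbols.1 hδ).2.1, (mem_markedSymbols.1 hδ).2.2⟩
  rw [← Finset.sum_fiberwise_of_maps_to (t := Z) (g := OddDurfeeSymbol.subscripts)
      (fun δ hδ => Finset.mem_union_left _ (Finset.mem_image_of_mem _ hδ)),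
    Finset.card_eq_sum_card_fiberwise (t := Z) (f := fun δ => δ.toSymbol.subscripts)
      (fun δ hδ => Finset.mem_coe.2
        (Finset.mem_union_right _ (Finset.mem_image_of_mem _ (Finset.mem_coe.1 hδ)))),
    Nat.cast_sum]
  refine Finset.sum_congr rfl fun z hz => ?_
  rw [sum_symbols_filter_subscripts k n (hZ z hz), rowPairMoment_eq_card,
    card_markedSymbols_filter_subscripts k n (hZ z hz)]
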